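/- Let $K$ be a field with algebraic closure $\overline K$, and let $\Delta(t,u)\in K[[t]][u]$. (1) If $\Delta$ has a square root in $K[[t,u]]$, then $\Delta$ can be factored in $\overline K[[t]][u]$ as $$\Delta(t,u)= c^2 t^{2p}\,(1+tS(t))\,\bigl(1+tuR_1(t,u)\bigr)\,\bigl(u^d+tR_2(t,u)\bigr)^2\prod_{i=1}^k\left(\Bigl(1-\frac u{\alpha_i}\Bigr)^{d_i}+tuQ_i(t,u)\right),$$ where $p,d,k$ are nonnegative integers, the $d_i$ are positive integers, $c\in K$, the $\alpha_i$ are pairwise distinct non-zero elements of $\overline K$, $S\in K[[t]]$, $R_1,R_2\in K[[t]][u]$ with $\deg_u R_2<d$, and $Q_i\in\overline K[[t]][u]$ with $\deg_u Q_i<d_i$ (here $\deg_u 0=-\infty$). (2) If $\Delta$ has a square root in $K[u][[t]]$, then $\Delta$ can be factored in $\overline K[[t]][u]$ as $$\Delta(t,u)= c^2 t^{2p}\,(1+tS(t))\,\bigl(1+tuR_1(t,u)\bigr)\,\bigl(u^d+tR_2(t,u)\bigr)^2\prod_{i=1}^k\left(\Bigl(1-\frac u{\alpha_i}\Bigr)^{d_i}+tuQ_i(t,u)\right)^2,$$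 with the same conditions as in (1). -/

import Mathlib

namespace BrownSquare

/-- The variable `t` of `K[[t]][u]`. -/
noncomputable def tVar (K : Type*) [Field K] : Polynomial (PowerSeries K) :=
  Polynomial.C PowerSeries.X

/-- The variable `u` of `K[[t]][u]`. -/
noncomputable def uVar (K : Type*) [Field K] : Polynomial (PowerSeries K) :=
  Polynomial.X

/-- The inclusion of `K[[t]][u]` in `K[u][[t]]`: it sends `t` to `t` and `u` to `u`
(the coefficient of `t^n u^m` is unchanged). -/
noncomputable def toPolySeries (K : Type*) [Field K] :
    Polynomial (PowerSeries K) →+* PowerSeries (Polynomial K) :=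
  Polynomial.eval₂RingHom (PowerSeries.map Polynomial.C) (PowerSeries.C Polynomial.X)

/-- The inclusion of `K[[t]][u]` in `K̄[[t]][u]`, where `K̄` is the algebraic closure of `K`. -/
noncomputable def baseChange (K : Type*) [Field K] :
    Polynomial (PowerSeries K) →+* Polynomial (PowerSeries (AlgebraicClosure K)) :=
  Polynomial.mapRingHom (PowerSeries.map (algebraMap K (AlgebraicClosure K)))

/-- `Δ` has a square root in `K[[t,u]] = K[[t]][[u]]`. -/
def HasSqrtInSeries {K : Type*} [Field K] (Δ : Polynomial (PowerSeries K)) : Prop :=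
  ∃ δ : PowerSeries (PowerSeries K), (Δ : PowerSeries (PowerSeries K)) = δ ^ 2

/-- `Δ` has a square root in `K[u][[t]]`. -/
def HasSqrtInPolySeries {K : Type*} [Field K] (Δ : Polynomial (PowerSeries K)) : Prop :=
  ∃ δ : PowerSeries (Polynomial K), toPolySeries K Δ = δ ^ 2

/-- The element `1 + t S(t)`. -/
noncomputable def unitFactor {K : Type*} [Field K] (S : PowerSeries K) :
    Polynomial (PowerSeries K) :=
  1 + tVar K * Polynomial.C S

/-- The factor `1 + t u R₁(t,u)`. -/
noncomputable def infFactor {K : Type*} [Field K] (R₁ : Polynomial (PowerSeries K)) :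
    Polynomial (PowerSeries K) :=
  1 + tVar K * uVar K * R₁

/-- The factor `u^d + t R₂(t,u)`. -/
noncomputable def zeroFactor {K : Type*} [Field K] (d : ℕ) (R₂ : Polynomial (PowerSeries K)) :
    Polynomial (PowerSeries K) :=
  uVar K ^ d + tVar K * R₂

/-- The factor `(1 - u/α)^e + t u Q(t,u)` (used for `α ≠ 0` only). -/
noncomputable def finFactor {L : Type*} [Field L] (α : L) (e : ℕ)
    (Q : Polynomial (PowerSeries L)) : Polynomial (PowerSeries L) :=
  (1 - Polynomial.C (PowerSeries.C α⁻¹) * uVar L) ^ e + tVar L * uVar L * Q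

end BrownSquare

/-!
After division by a power of `t`, whose exponent must be even since `t` is prime, `Δ` is nonzero
modulo `t`. Its roots, as functions of `t`, then either tend to infinity or tend to a root `α` of
`Δ mod t`, and Weierstrass preparation at `u = α` splits off the monic factor whose roots tend to
`α`. The factor `1 + t u R₁` collects the roots tending to infinity; it is the reverse of the factor
at `0` of the reversed polynomial.

If `δ² = Δ` in `K[[t, u]]`, squaring the Weierstrass factorization of `δ` gives that of `Δ`, so by
uniqueness the factor at `0` is a square, and so is the value at `u = 0` of its cofactor: this value
is `c² (1 + t S)`. If `δ` lies in `K[u][[t]]`, one may substitute `u + α` for `u` in it, so the same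
argument applies at every `α`.
-/

namespace BrownSquare

open IsLocalRing
open Polynomial hiding constantCoeff
open PowerSeries (constantCoeff)
open scoped PowerSeries

theorem exists_eq_sq_of_prime_pow_mul_eq_sq {M : Type*} [CommMonoidWithZero M] [IsCancelMulZero M]
    {q a b : M} {n : ℕ} (hq : Prime q) (ha : ¬ q ∣ a) (h : q ^ n * a = b ^ 2) :
    ∃ p c, n = 2 * p ∧ a = c ^ 2 := by
  induction n using Nat.twoStepInduction generalizing b with
  | zero => exact ⟨0, b, rfl, by rwa [pow_zero, one_mul] at h⟩
  | one =>
    obtain ⟨c, rfl⟩ : q ∣ b :=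
      hq.dvd_of_dvd_pow (h ▸ dvd_mul_of_dvd_left (dvd_pow_self q one_ne_zero) a)
    rw [pow_one, mul_pow, sq, mul_assoc] at h
    exact absurd ⟨c ^ 2, mul_left_cancel₀ hq.ne_zero h⟩ ha
  | more n ih _ =>
    obtain ⟨c, rfl⟩ : q ∣ b :=
      hq.dvd_of_dvd_pow (h ▸ dvd_mul_of_dvd_left (dvd_pow_self q (by omega)) a)
    rw [pow_add, mul_pow, mul_comm (q ^ n), mul_assoc] at h
    obtain ⟨p, c, rfl, hc⟩ := ih (mul_left_cancel₀ (pow_ne_zero 2 hq.ne_zero) h)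
    exact ⟨p + 1, c, by ring, hc⟩

section Weierstrass

variable {A : Type*} [CommRing A] [IsLocalRing A] [IsAdicComplete (maximalIdeal A) A]

theorem exists_coe_eq_of_isDistinguishedAt_mul_eq_coe {P f : A[X]} {h : A⟦X⟧}
    (hP : P.IsDistinguishedAt (maximalIdeal A)) (hf : (P : A⟦X⟧) * h = f) :
    ∃ g : A[X], (g : A⟦X⟧) = h := by
  have hdeg : P.natDegree = ((P : A⟦X⟧).map (Ideal.Quotient.mk (maximalIdeal A))).order.toNat := by
    rw [← hP.coe_natDegree_eq_order_map (P : A⟦X⟧) 1 (by simp) (by simp), ENat.toNat_natCast]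
  have hmod : (f %ₘ P).degree < P.natDegree := by
    rw [← degree_eq_natDegree hP.monic.ne_zero]
    exact degree_modByMonic_lt f hP.monic
  have hdiv : (P : A⟦X⟧) * (f /ₘ P : A[X]) + (f %ₘ P : A[X]) = P * h + (0 : A[X]) := by
    rw [Polynomial.coe_zero, add_zero, hf, ← Polynomial.coe_mul, ← Polynomial.coe_add, add_comm,
      modByMonic_add_div]
  exact ⟨f /ₘ P, (hP.isWeierstrassDivisorAt'.eq_of_mul_add_eq_mul_add (hdeg ▸ hmod)
    (by simp) hdiv).1⟩

theorem exists_eq_isDistinguishedAt_mul {f : A[X]} (hf : f.map (residue A) ≠ 0) :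
    ∃ P g : A[X], P.IsDistinguishedAt (maximalIdeal A) ∧ IsUnit (g.coeff 0) ∧ f = P * g := by
  obtain ⟨P, h, H⟩ := PowerSeries.exists_isWeierstrassFactorization (g := (f : A⟦X⟧)) (by
    rw [← polynomial_map_coe]
    exact_mod_cast hf)
  obtain ⟨g, rfl⟩ := exists_coe_eq_of_isDistinguishedAt_mul_eq_coe H.isDistinguishedAt H.eq_mul.symm
  refine ⟨P, g, H.isDistinguishedAt, ?_, Polynomial.coe_injective A ?_⟩
  · simpa using PowerSeries.isUnit_iff_constantCoeff.1 H.isUnit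
  · rw [H.eq_mul, Polynomial.coe_mul]

theorem exists_eq_sq_of_isWeierstrassFactorization_sq {P : A[X]} {h δ : A⟦X⟧}
    (H : (δ ^ 2).IsWeierstrassFactorization P h) :
    ∃ (Q : A[X]) (v : A⟦X⟧), Q.IsDistinguishedAt (maximalIdeal A) ∧ P = Q ^ 2 ∧ h = v ^ 2 := by
  have hδ : δ.map (residue A) ≠ 0 := fun h0 ↦
    H.map_ne_zero (by rw [map_pow, h0, zero_pow two_ne_zero])
  obtain ⟨Q, v, HQ⟩ := PowerSeries.exists_isWeierstrassFactorization hδ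
  have HQ2 := HQ.mul HQ
  rw [← sq, ← sq, ← sq] at HQ2
  exact ⟨Q, v, HQ.isDistinguishedAt, H.elim HQ2⟩

end Weierstrass

section Reduction

variable {k : Type*} [Field k]

instance isAdicComplete_maximalIdeal : IsAdicComplete (maximalIdeal k⟦X⟧) k⟦X⟧ := by
  rw [PowerSeries.maximalIdeal_eq_span_X]
  infer_instance

theorem mem_maximalIdeal_iff_constantCoeff {x : k⟦X⟧} :
    x ∈ maximalIdeal k⟦X⟧ ↔ constantCoeff x = 0 := by
  rw [PowerSeries.maximalIdeal_eq_span_X, Ideal.mem_span_singleton, PowerSeries.X_dvd_iff]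

theorem map_residue_eq_zero_iff {f : k⟦X⟧[X]} :
    f.map (residue k⟦X⟧) = 0 ↔ f.map constantCoeff = 0 := by
  simp only [Polynomial.ext_iff, coeff_map, coeff_zero, residue_eq_zero_iff,
    mem_maximalIdeal_iff_constantCoeff]

theorem tVar_dvd_iff {f : k⟦X⟧[X]} : tVar k ∣ f ↔ f.map constantCoeff = 0 := by
  simp only [tVar, C_dvd_iff_dvd_coeff, PowerSeries.X_dvd_iff, Polynomial.ext_iff, coeff_map,
    coeff_zero]

theorem prime_tVar : Prime (tVar k) :=
  prime_C_iff.2 PowerSeries.X_prime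

theorem exists_eq_tVar_pow_mul {f : k⟦X⟧[X]} (hf : f ≠ 0) :
    ∃ (n : ℕ) (g : k⟦X⟧[X]), f = tVar k ^ n * g ∧ g.map constantCoeff ≠ 0 := by
  obtain ⟨g, hg, hndvd⟩ :=
    (FiniteMultiplicity.of_prime_left prime_tVar hf).exists_eq_pow_mul_and_not_dvd
  exact ⟨_, g, hg, mt tVar_dvd_iff.2 hndvd⟩

theorem exists_eq_tVar_mul {f : k⟦X⟧[X]} (hf : f.map constantCoeff = 0) :
    ∃ R : k⟦X⟧[X], f = tVar k * R ∧ R.degree = f.degree := by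
  obtain ⟨R, rfl⟩ := tVar_dvd_iff.2 hf
  exact ⟨R, rfl, by rw [tVar, degree_C_mul PowerSeries.X_ne_zero]⟩

theorem exists_eq_tVar_mul_uVar_mul {f : k⟦X⟧[X]} (hf : f.map constantCoeff = 0)
    (hf0 : f.coeff 0 = 0) :
    ∃ R : k⟦X⟧[X], f = tVar k * uVar k * R ∧ (uVar k * R).degree = f.degree := by
  obtain ⟨R', rfl, hdeg⟩ := exists_eq_tVar_mul hf
  rw [tVar, coeff_C_mul, mul_eq_zero, or_iff_right PowerSeries.X_ne_zero, ← X_dvd_iff] at hf0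
  obtain ⟨R, rfl⟩ := hf0
  exact ⟨R, by rw [uVar, mul_assoc], hdeg⟩

theorem exists_eq_C_mul_of_constantCoeff_ne_zero {f : k⟦X⟧[X]}
    (hf : constantCoeff (f.coeff 0) ≠ 0) :
    ∃ g : k⟦X⟧[X], g.coeff 0 = 1 ∧ f = C (f.coeff 0) * g :=
  ⟨C (f.coeff 0)⁻¹ * f, by rw [coeff_C_mul, PowerSeries.inv_mul_cancel _ hf], by
    rw [← mul_assoc, ← C_mul, PowerSeries.mul_inv_cancel _ hf, C_1, one_mul]⟩

end Reduction

section Factors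

variable {k : Type*} [Field k]

@[simp]
theorem map_constantCoeff_tVar : (tVar k).map constantCoeff = 0 := by simp [tVar]

@[simp]
theorem map_constantCoeff_uVar : (uVar k).map constantCoeff = X := by simp [uVar]

@[simp]
theorem map_constantCoeff_unitFactor (S : k⟦X⟧) : (unitFactor S).map constantCoeff = 1 := by
  simp [unitFactor]

@[simp]
theorem map_constantCoeff_infFactor (R : k⟦X⟧[X]) : (infFactor R).map constantCoeff = 1 := by
  simp [infFactor]

@[simp]
theorem map_constantCoeff_zeroFactor (d : ℕ) (R : k⟦X⟧[X]) :
    (zeroFactor d R).map constantCoeff = X ^ d := by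
  simp [zeroFactor]

@[simp]
theorem eval_zero_finFactor (α : k) (e : ℕ) (Q : k⟦X⟧[X]) : (finFactor α e Q).eval 0 = 1 := by
  simp [finFactor, uVar]

theorem exists_eq_C_sq_mul_unitFactor {v : k⟦X⟧} (hv : constantCoeff v ≠ 0) :
    ∃ S : k⟦X⟧, C (v ^ 2) = C (PowerSeries.C (constantCoeff v)) ^ 2 * unitFactor S := by
  set c := constantCoeff v with hc
  obtain ⟨S, hS⟩ : PowerSeries.X ∣ PowerSeries.C (c ^ 2)⁻¹ * v ^ 2 - 1 := by
    rw [PowerSeries.X_dvd_iff]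
    simp [← hc, hv]
  have hvS : v ^ 2 = PowerSeries.C c ^ 2 * (1 + PowerSeries.X * S) := by
    rw [← hS, add_sub_cancel, ← mul_assoc, ← map_pow PowerSeries.C, ← map_mul PowerSeries.C,
      mul_inv_cancel₀ (pow_ne_zero 2 hv), map_one, one_mul]
  exact ⟨S, by rw [hvS, unitFactor, tVar, C_mul, C_pow, C_add, C_mul, C_1]⟩

theorem exists_eq_infFactor {f : k⟦X⟧[X]} (hf : f.map constantCoeff = 1) (hf0 : f.coeff 0 = 1) :
    ∃ R, f = infFactor R := by
  obtain ⟨R, hR, -⟩ := exists_eq_tVar_mul_uVar_mul (f := f - 1) (by simp [hf]) (by simp [hf0])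
  exact ⟨R, by rw [infFactor, ← hR, add_sub_cancel]⟩

theorem exists_eq_finFactor {f : k⟦X⟧[X]} {α : k} {e : ℕ} (hdeg : f.natDegree ≤ e)
    (hf : f.map constantCoeff = (1 - C α⁻¹ * X) ^ e) (hf0 : f.coeff 0 = 1) :
    ∃ Q : k⟦X⟧[X], Q.degree < (e : WithBot ℕ) ∧ f = finFactor α e Q := by
  obtain ⟨Q, hQ, hQdeg⟩ := exists_eq_tVar_mul_uVar_mul
    (f := f - (1 - C (PowerSeries.C α⁻¹) * uVar k) ^ e) (by simp [hf])
    (by rw [coeff_sub, hf0]; simp [uVar, coeff_zero_eq_eval_zero])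
  refine ⟨Q, ?_, by rw [finFactor, ← hQ, add_sub_cancel]⟩
  rcases eq_or_ne Q 0 with rfl | hQ0
  · exact degree_zero.trans_lt (WithBot.bot_lt_coe _)
  calc Q.degree < (Q * X).degree := degree_lt_degree_mul_X hQ0
    _ = (f - (1 - C (PowerSeries.C α⁻¹) * uVar k) ^ e).degree := by rw [mul_comm, ← uVar, hQdeg]
    _ ≤ e := by
      refine (degree_sub_le_of_le (degree_le_of_natDegree_le hdeg)
        (degree_le_of_natDegree_le ?_)).trans (max_self _).le
      rw [uVar]
      compute_degree

end Factors

section Concentrated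

/-- `P ∈ R[[t]][u]` is concentrated at `α ∈ R` if it is monic and reduces to a power of `u - α`
modulo `t`; for `R` a field, this says that all the roots of `P` tend to `α` as `t → 0`. For `α = 0`
these are the distinguished polynomials of the Weierstrass preparation theorem. -/
structure IsConcentratedAt {R : Type*} [CommRing R] (P : R⟦X⟧[X]) (α : R) : Prop where
  monic : P.Monic
  map_constantCoeff : P.map constantCoeff = (X - C α) ^ P.natDegree

theorem isConcentratedAt_one {R : Type*} [CommRing R] (α : R) :
    IsConcentratedAt (1 : R⟦X⟧[X]) α :=
  ⟨monic_one, by simp⟩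

variable {k : Type*} [Field k]

theorem isConcentratedAt_iff_isDistinguishedAt_taylor {P : k⟦X⟧[X]} {α : k} :
    IsConcentratedAt P α ↔
      (taylor (PowerSeries.C α) P).IsDistinguishedAt (maximalIdeal k⟦X⟧) := by
  have hmonic : (taylor (PowerSeries.C α) P).Monic ↔ P.Monic := by
    rw [Monic, leadingCoeff_taylor, Monic]
  have hmap : (taylor (PowerSeries.C α) P).map constantCoeff = X ^ P.natDegree ↔
      P.map constantCoeff = (X - C α) ^ P.natDegree := by
    rw [map_taylor, PowerSeries.constantCoeff_C, ← taylor_inj (r := α) (q := (X - C α) ^ _),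
      taylor_pow, map_sub, taylor_X, taylor_C, add_sub_cancel_right]
  constructor
  · intro hP
    refine ⟨⟨fun {i} hi ↦ ?_⟩, hmonic.2 hP.monic⟩
    rw [natDegree_taylor] at hi
    rw [mem_maximalIdeal_iff_constantCoeff, ← coeff_map, hmap.2 hP.map_constantCoeff,
      coeff_X_pow, if_neg hi.ne]
  · intro hP
    refine ⟨hmonic.1 hP.monic, hmap.1 ?_⟩
    ext i
    rw [coeff_map, coeff_X_pow, ← natDegree_taylor P (PowerSeries.C α)]
    rcases lt_trichotomy i (taylor (PowerSeries.C α) P).natDegree with hi | rfl | hi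
    · rw [mem_maximalIdeal_iff_constantCoeff.1 (hP.mem hi), if_neg hi.ne]
    · rw [hP.monic.coeff_natDegree, map_one, if_pos rfl]
    · rw [coeff_eq_zero_of_natDegree_lt hi, map_zero, if_neg hi.ne']

theorem exists_eq_isConcentratedAt_mul {f : k⟦X⟧[X]} (hf : f.map constantCoeff ≠ 0) (α : k) :
    ∃ P g : k⟦X⟧[X], IsConcentratedAt P α ∧ (g.map constantCoeff).eval α ≠ 0 ∧ f = P * g := by
  obtain ⟨P, g, hP, hg, hfPg⟩ := exists_eq_isDistinguishedAt_mul
    (f := taylor (PowerSeries.C α) f) (by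
      rwa [Ne, map_residue_eq_zero_iff, map_taylor, taylor_eq_zero])
  refine ⟨taylor (-PowerSeries.C α) P, taylor (-PowerSeries.C α) g, ?_, ?_, ?_⟩
  · rwa [isConcentratedAt_iff_isDistinguishedAt_taylor, taylor_taylor, add_neg_cancel, taylor_zero]
  · rw [map_taylor, taylor_eval, map_neg, PowerSeries.constantCoeff_C, add_neg_cancel,
      ← coeff_zero_eq_eval_zero, coeff_map]
    exact (hg.map constantCoeff).ne_zero
  · rw [← taylor_mul, ← hfPg, taylor_taylor, neg_add_cancel, taylor_zero]

namespace IsConcentratedAt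

variable {P : k⟦X⟧[X]} {α : k}

theorem exists_eq_zeroFactor (hP : IsConcentratedAt P 0) :
    ∃ R : k⟦X⟧[X], R.degree < (P.natDegree : WithBot ℕ) ∧ P = zeroFactor P.natDegree R := by
  obtain ⟨R, hR, hdeg⟩ := exists_eq_tVar_mul (f := P - X ^ P.natDegree)
    (by simp [hP.map_constantCoeff])
  refine ⟨R, ?_, by rw [zeroFactor, ← hR, uVar, add_sub_cancel]⟩
  have h := degree_eq_natDegree hP.monic.ne_zero
  rw [hdeg, ← h]
  exact degree_sub_lt_left (by rw [degree_X_pow, h]) hP.monic.ne_zero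
    (by rw [leadingCoeff_X_pow, hP.monic.leadingCoeff])

theorem exists_reverse_eq_infFactor (hP : IsConcentratedAt P 0) :
    ∃ R, P.reverse = infFactor R := by
  refine exists_eq_infFactor ?_ (by rw [coeff_zero_reverse, hP.monic.leadingCoeff])
  rw [reverse, ← reflect_map, hP.map_constantCoeff, C_0, sub_zero, reflect_monomial,
    revAt_le le_rfl, Nat.sub_self, pow_zero]

theorem exists_eq_C_mul_finFactor (hP : IsConcentratedAt P α) (hα : α ≠ 0) :
    ∃ (v : k⟦X⟧) (Q : k⟦X⟧[X]), Q.degree < (P.natDegree : WithBot ℕ) ∧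
      P = C v * finFactor α P.natDegree Q := by
  have hlinear : X - C α = C (-α) * (1 - C α⁻¹ * X) := by
    rw [mul_sub, ← mul_assoc, ← C_mul, neg_mul, mul_inv_cancel₀ hα]
    simp only [C_neg, C_1]
    ring
  have hP0 : constantCoeff (P.coeff 0) = (-α) ^ P.natDegree := by
    rw [← coeff_map, hP.map_constantCoeff, coeff_zero_eq_eval_zero]
    simp
  have hα' : (-α) ^ P.natDegree ≠ 0 := pow_ne_zero _ (neg_ne_zero.2 hα)
  obtain ⟨f, hf0, hPf⟩ := exists_eq_C_mul_of_constantCoeff_ne_zero (hP0 ▸ hα')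
  have hf : f.map constantCoeff = (1 - C α⁻¹ * X) ^ P.natDegree := by
    refine mul_left_cancel₀ (C_ne_zero.2 hα') ?_
    rw [C_pow, ← mul_pow, ← hlinear, ← hP.map_constantCoeff, ← C_pow, ← hP0, ← map_C,
      ← Polynomial.map_mul, ← hPf]
  have hdeg : f.natDegree = P.natDegree := by
    conv_rhs => rw [hPf]
    refine (natDegree_C_mul fun h ↦ hα' ?_).symm
    rw [← hP0, h, map_zero]
  obtain ⟨Q, hQ, hfQ⟩ := exists_eq_finFactor hdeg.le hf hf0
  exact ⟨P.coeff 0, Q, hQ, hfQ ▸ hPf⟩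

theorem natDegree_pos {G : k⟦X⟧[X]} (hP : IsConcentratedAt P α)
    (hroot : ((P * G).map constantCoeff).eval α = 0) (hG : (G.map constantCoeff).eval α ≠ 0) :
    0 < P.natDegree := by
  rw [Polynomial.map_mul, eval_mul, hP.map_constantCoeff, mul_eq_zero, or_iff_left hG] at hroot
  refine Nat.pos_of_ne_zero fun h ↦ ?_
  rw [h, pow_zero, eval_one] at hroot
  exact one_ne_zero hroot

theorem exists_eq_sq {G : k⟦X⟧[X]} (hP : IsConcentratedAt P α)
    (hG : (G.map constantCoeff).eval α ≠ 0)
    (h : HasSqrtInSeries (taylor (PowerSeries.C α) (P * G))) :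
    ∃ (Q : k⟦X⟧[X]) (v : k⟦X⟧),
      IsConcentratedAt Q α ∧ P = Q ^ 2 ∧ G.eval (PowerSeries.C α) = v ^ 2 := by
  obtain ⟨δ, hδ⟩ := h
  have hunit : IsUnit (taylor (PowerSeries.C α) G : k⟦X⟧⟦X⟧) := by
    rw [PowerSeries.isUnit_iff_constantCoeff, Polynomial.constantCoeff_coe, taylor_coeff_zero,
      PowerSeries.isUnit_iff_constantCoeff, isUnit_iff_ne_zero]
    rwa [eval_map, ← PowerSeries.constantCoeff_C α, eval₂_at_apply] at hG
  obtain ⟨Q, v, hQ, hPQ, hGv⟩ := exists_eq_sq_of_isWeierstrassFactorization_sq (δ := δ)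
    ⟨isConcentratedAt_iff_isDistinguishedAt_taylor.1 hP, hunit, by
      rw [← hδ, taylor_mul, Polynomial.coe_mul]⟩
  refine ⟨taylor (-PowerSeries.C α) Q, PowerSeries.constantCoeff v, ?_, ?_, ?_⟩
  · rwa [isConcentratedAt_iff_isDistinguishedAt_taylor, taylor_taylor, add_neg_cancel, taylor_zero]
  · rw [← taylor_pow, ← hPQ, taylor_taylor, neg_add_cancel, taylor_zero]
  · rw [← map_pow, ← hGv, Polynomial.constantCoeff_coe, taylor_coeff_zero]

end IsConcentratedAt

end Concentrated

section Infinity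

theorem reverse_reverse_of_coeff_zero_ne_zero {R : Type*} [Semiring R] {f : R[X]}
    (hf : f.coeff 0 ≠ 0) : f.reverse.reverse = f := by
  have h : f.reverse.natDegree = f.natDegree := by
    rw [reverse_natDegree, natTrailingDegree_eq_zero.2 (Or.inr hf), Nat.sub_zero]
  rw [reverse, h, reverse, reflect_reflect]

theorem exists_eq_infFactor_mul {k : Type*} [Field k] {f : k⟦X⟧[X]} (hf : f.coeff 0 = 1) :
    ∃ R F : k⟦X⟧[X], F.coeff 0 = 1 ∧ F.natDegree ≤ (F.map constantCoeff).natDegree ∧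
      f = infFactor R * F := by
  have hf0 : f.coeff 0 ≠ 0 := hf ▸ one_ne_zero
  have hmonic : f.reverse.Monic := by
    rw [Monic, reverse_leadingCoeff, trailingCoeff, natTrailingDegree_eq_zero.2 (Or.inr hf0), hf]
  obtain ⟨P, W, hP, hW, hPW⟩ :=
    exists_eq_isConcentratedAt_mul (hmonic.map constantCoeff).ne_zero (0 : k)
  have hWmonic : W.Monic := hP.monic.of_mul_monic_left (hPW ▸ hmonic)
  obtain ⟨R, hR⟩ := hP.exists_reverse_eq_infFactor
  refine ⟨R, W.reverse, by rw [coeff_zero_reverse, hWmonic.leadingCoeff], ?_, ?_⟩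
  · refine (reverse_natDegree_le W).trans (le_natDegree_of_ne_zero ?_)
    rwa [coeff_map, coeff_reverse, revAt_le le_rfl, Nat.sub_self, ← coeff_map,
      coeff_zero_eq_eval_zero]
  · rw [← hR, ← reverse_mul_of_domain, ← hPW, reverse_reverse_of_coeff_zero_ne_zero hf0]

end Infinity

section FiniteRoots

variable {L : Type*} [Field L]

theorem exists_eq_prod_isConcentratedAt_mul {F : L⟦X⟧[X]} (hF : F.map constantCoeff ≠ 0)
    (s : Finset L) :
    ∃ (P : L → L⟦X⟧[X]) (U : L⟦X⟧[X]), (∀ α, IsConcentratedAt (P α) α) ∧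
      (∀ α ∈ s, (U.map constantCoeff).eval α ≠ 0) ∧ F = (∏ α ∈ s, P α) * U := by
  classical
  induction s using Finset.induction_on with
  | empty => exact ⟨1, F, isConcentratedAt_one, by simp, by simp⟩
  | insert a s ha ih =>
    obtain ⟨P, U, hP, hU, rfl⟩ := ih
    have hU0 : U.map constantCoeff ≠ 0 := fun h ↦ hF (by rw [Polynomial.map_mul, h, mul_zero])
    obtain ⟨P', V, hP', hV, rfl⟩ := exists_eq_isConcentratedAt_mul hU0 a
    refine ⟨Function.update P a P', V, fun α ↦ ?_, fun α hα ↦ ?_, ?_⟩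
    · rcases eq_or_ne α a with rfl | hne
      · rwa [Function.update_self]
      · rw [Function.update_of_ne hne]
        exact hP α
    · rcases Finset.mem_insert.1 hα with rfl | hαs
      · exact hV
      · refine right_ne_zero_of_mul (a := (P'.map constantCoeff).eval α) ?_
        rw [← eval_mul, ← Polynomial.map_mul]
        exact hU α hαs
    · rw [Finset.prod_insert ha, Function.update_self, Finset.prod_update_of_notMem ha]
      ring

theorem exists_prod_isConcentratedAt_mul_eq {P : L → L⟦X⟧[X]} (hP : ∀ α, IsConcentratedAt (P α) α)
    {U : L⟦X⟧[X]} {s : Finset L} {α : L} (hα : α ∈ s) (hU : (U.map constantCoeff).eval α ≠ 0) :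
    ∃ G : L⟦X⟧[X], (∏ β ∈ s, P β) * U = P α * G ∧ (G.map constantCoeff).eval α ≠ 0 := by
  classical
  refine ⟨(∏ β ∈ s.erase α, P β) * U, by rw [← mul_assoc, Finset.mul_prod_erase s P hα], ?_⟩
  rw [Polynomial.map_mul, eval_mul, Polynomial.map_prod, eval_prod]
  refine mul_ne_zero (Finset.prod_ne_zero_iff.2 fun β hβ ↦ ?_) hU
  rw [(hP β).map_constantCoeff, eval_pow, eval_sub, eval_X, eval_C]
  exact pow_ne_zero _ (sub_ne_zero.2 (Finset.ne_of_mem_erase hβ).symm)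

theorem exists_eq_prod_isConcentratedAt_mul_C [IsAlgClosed L] {F : L⟦X⟧[X]}
    (hF : F.map constantCoeff ≠ 0) (hdeg : F.natDegree ≤ (F.map constantCoeff).natDegree) :
    ∃ (s : Finset L) (P : L → L⟦X⟧[X]) (w : L⟦X⟧), (∀ α ∈ s, (F.map constantCoeff).eval α = 0) ∧
      (∀ α, IsConcentratedAt (P α) α) ∧ constantCoeff w ≠ 0 ∧ F = (∏ α ∈ s, P α) * C w := by
  classical
  set s := (F.map constantCoeff).roots.toFinset with hs
  have hmem (α : L) : α ∈ s ↔ (F.map constantCoeff).eval α = 0 := by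
    rw [hs, Multiset.mem_toFinset, mem_roots hF, IsRoot.def]
  obtain ⟨P, U, hP, hU, hFU⟩ := exists_eq_prod_isConcentratedAt_mul hF s
  set M := ∏ α ∈ s, P α
  have hredF : F.map constantCoeff = M.map constantCoeff * U.map constantCoeff := by
    rw [← Polynomial.map_mul, ← hFU]
  have hredU : U.map constantCoeff ≠ 0 := fun h ↦ hF (by rw [hredF, h, mul_zero])
  have hredUdeg : (U.map constantCoeff).natDegree = 0 := by
    by_contra h
    obtain ⟨α, hα⟩ := IsAlgClosed.exists_root (U.map constantCoeff)
      (fun h' ↦ h (natDegree_eq_of_degree_eq_some h'))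
    exact hU α ((hmem α).2 (by rw [hredF, eval_mul, hα, mul_zero])) hα
  have hUdeg : U.natDegree = 0 := by
    have hM : M.Monic := monic_prod_of_monic _ _ fun α _ ↦ (hP α).monic
    have hU0 : U ≠ 0 := fun h ↦ hredU (by rw [h, Polynomial.map_zero])
    have hle : (F.map constantCoeff).natDegree ≤ M.natDegree := calc
      _ = (M.map constantCoeff * U.map constantCoeff).natDegree := by rw [hredF]
      _ ≤ (M.map constantCoeff).natDegree + (U.map constantCoeff).natDegree := natDegree_mul_le
      _ ≤ M.natDegree := by rw [hredUdeg, add_zero]; exact natDegree_map_le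
    have hadd : F.natDegree = M.natDegree + U.natDegree := by
      conv_lhs => rw [hFU, hM.natDegree_mul' hU0]
    omega
  obtain ⟨w, rfl⟩ := natDegree_eq_zero.1 hUdeg
  rw [map_C, C_ne_zero] at hredU
  exact ⟨s, P, w, fun α ↦ (hmem α).1, hP, hredU, hFU⟩

/-- `f` is a product of factors `(1 - u/αᵢ)^{eᵢ} + t u Qᵢ` with `αᵢ` distinct and nonzero, `eᵢ > 0`
and `deg Qᵢ < eᵢ`: the shape of the last product in the factorization theorem. -/
def IsProdFinFactor (f : L⟦X⟧[X]) : Prop :=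
  ∃ (n : ℕ) (α : Fin n → L) (e : Fin n → ℕ) (Q : Fin n → L⟦X⟧[X]), Function.Injective α ∧
    (∀ i, α i ≠ 0 ∧ 0 < e i ∧ (Q i).degree < (e i : WithBot ℕ)) ∧
    f = ∏ i, finFactor (α i) (e i) (Q i)

theorem IsProdFinFactor.coeff_zero {f : L⟦X⟧[X]} (hf : IsProdFinFactor f) : f.coeff 0 = 1 := by
  obtain ⟨n, α, e, Q, -, -, rfl⟩ := hf
  simp only [coeff_zero_eq_eval_zero, eval_prod, eval_zero_finFactor, Finset.prod_const_one]

theorem exists_isProdFinFactor_of_isConcentratedAt {s : Finset L} {P : L → L⟦X⟧[X]}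
    (hs : ∀ α ∈ s, α ≠ 0 ∧ IsConcentratedAt (P α) α ∧ 0 < (P α).natDegree) :
    ∃ (v : L⟦X⟧) (f : L⟦X⟧[X]), IsProdFinFactor f ∧ ∏ α ∈ s, P α = C v * f := by
  have hfac (α : s) := (hs α α.2).2.1.exists_eq_C_mul_finFactor (hs α α.2).1
  choose v Q hQ hP using hfac
  let φ := s.equivFin.symm
  refine ⟨∏ α, v α, ∏ α : s, finFactor α.1 (P α).natDegree (Q α),
    ⟨s.card, fun i ↦ φ i, fun i ↦ (P (φ i)).natDegree, fun i ↦ Q (φ i),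
      Subtype.val_injective.comp φ.injective,
      fun i ↦ ⟨(hs _ (φ i).2).1, (hs _ (φ i).2).2.2, hQ _⟩, (φ.prod_comp _).symm⟩, ?_⟩
  rw [← Finset.prod_coe_sort, map_prod, ← Finset.prod_mul_distrib]
  exact Finset.prod_congr rfl fun α _ ↦ hP α

theorem eq_of_eq_C_mul {R : Type*} [Semiring R] {f g : R[X]} {w : R} (h : f = C w * g)
    (hf : f.coeff 0 = 1) (hg : g.coeff 0 = 1) : f = g := by
  rw [h, coeff_C_mul, hg, mul_one] at hf
  rw [h, hf, C_1, one_mul]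

variable [IsAlgClosed L]

theorem exists_eq_prod_isConcentratedAt_mul_C_of_coeff_zero {F : L⟦X⟧[X]} (hF : F.coeff 0 = 1)
    (hdeg : F.natDegree ≤ (F.map constantCoeff).natDegree) :
    ∃ (s : Finset L) (P : L → L⟦X⟧[X]) (w : L⟦X⟧), F = (∏ α ∈ s, P α) * C w ∧
      ∀ α ∈ s, α ≠ 0 ∧ IsConcentratedAt (P α) α ∧ 0 < (P α).natDegree ∧
        ∃ G : L⟦X⟧[X], F = P α * G ∧ (G.map constantCoeff).eval α ≠ 0 := by
  have hF0 : (F.map constantCoeff).eval 0 = 1 := by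
    rw [← coeff_zero_eq_eval_zero, coeff_map, hF, map_one]
  have hred : F.map constantCoeff ≠ 0 := fun h ↦ by simp [h] at hF0
  obtain ⟨s, P, w, hs, hP, hw, hFw⟩ := exists_eq_prod_isConcentratedAt_mul_C hred hdeg
  refine ⟨s, P, w, hFw, fun α hα ↦ ?_⟩
  obtain ⟨G, hG, hGα⟩ := exists_prod_isConcentratedAt_mul_eq hP hα (U := C w) (by simpa using hw)
  rw [← hFw] at hG
  refine ⟨?_, hP α, (hP α).natDegree_pos (hG ▸ hs α hα) hGα, G, hG, hGα⟩
  rintro rfl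
  exact one_ne_zero (hF0 ▸ hs 0 hα)

theorem isProdFinFactor_of_natDegree_le {F : L⟦X⟧[X]} (hF : F.coeff 0 = 1)
    (hdeg : F.natDegree ≤ (F.map constantCoeff).natDegree) : IsProdFinFactor F := by
  obtain ⟨s, P, w, hFw, hs⟩ := exists_eq_prod_isConcentratedAt_mul_C_of_coeff_zero hF hdeg
  obtain ⟨v, f, hf, hPf⟩ := exists_isProdFinFactor_of_isConcentratedAt (P := P)
    fun α hα ↦ ⟨(hs α hα).1, (hs α hα).2.1, (hs α hα).2.2.1⟩
  have hFf : F = C (v * w) * f := by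
    rw [hFw, hPf, C_mul]
    ring
  exact eq_of_eq_C_mul hFf hF hf.coeff_zero ▸ hf

theorem exists_isProdFinFactor_eq_sq {V F : L⟦X⟧[X]} (hF : F.coeff 0 = 1)
    (hdeg : F.natDegree ≤ (F.map constantCoeff).natDegree)
    (hV : ∀ α ≠ 0, (V.map constantCoeff).eval α ≠ 0)
    (hsqrt : ∀ α ≠ 0, HasSqrtInSeries (taylor (PowerSeries.C α) (V * F))) :
    ∃ f, IsProdFinFactor f ∧ F = f ^ 2 := by
  obtain ⟨s, P, w, hFw, hs⟩ := exists_eq_prod_isConcentratedAt_mul_C_of_coeff_zero hF hdeg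
  have hsq : ∀ α ∈ s, ∃ Q : L⟦X⟧[X], IsConcentratedAt Q α ∧ P α = Q ^ 2 := by
    intro α hα
    obtain ⟨hα0, hPα, -, G, hG, hGα⟩ := hs α hα
    obtain ⟨Q, -, hQ, hPQ, -⟩ := hPα.exists_eq_sq (G := V * G)
      (by rw [Polynomial.map_mul, eval_mul]; exact mul_ne_zero (hV α hα0) hGα)
      (by rw [mul_left_comm, ← hG]; exact hsqrt α hα0)
    exact ⟨Q, hQ, hPQ⟩
  choose! Q hQ hPQ using hsq
  obtain ⟨v, f, hf, hQf⟩ := exists_isProdFinFactor_of_isConcentratedAt (P := Q) fun α hα ↦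
    ⟨(hs α hα).1, hQ α hα, Nat.pos_of_ne_zero fun h ↦ (hs α hα).2.2.1.ne' (by
      rw [hPQ α hα, natDegree_pow, h, mul_zero])⟩
  have hFf : F = C (v ^ 2 * w) * f ^ 2 := by
    rw [hFw, Finset.prod_congr rfl hPQ, Finset.prod_pow, hQf, C_mul, C_pow]
    ring
  refine ⟨f, hf, eq_of_eq_C_mul hFf hF ?_⟩
  rw [sq, mul_coeff_zero, hf.coeff_zero, one_mul]

end FiniteRoots

section SquareRoots

variable {K : Type*} [Field K]

theorem C_X_dvd_iff {R : Type*} [CommRing R] {f : R⟦X⟧⟦X⟧} :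
    PowerSeries.C PowerSeries.X ∣ f ↔ f.map constantCoeff = 0 := by
  constructor
  · rintro ⟨g, rfl⟩
    rw [map_mul, PowerSeries.map_C, PowerSeries.constantCoeff_X, map_zero, zero_mul]
  · intro h
    have hdvd (n : ℕ) : PowerSeries.X ∣ PowerSeries.coeff n f := by
      rw [PowerSeries.X_dvd_iff, ← PowerSeries.coeff_map, h, map_zero]
    choose g hg using hdvd
    exact ⟨PowerSeries.mk g, by ext1 n; rw [PowerSeries.coeff_C_mul, PowerSeries.coeff_mk, hg]⟩

theorem prime_C_X {R : Type*} [CommRing R] [IsDomain R] :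
    Prime (PowerSeries.C PowerSeries.X : R⟦X⟧⟦X⟧) := by
  refine ⟨?_, ?_, fun f g ↦ ?_⟩
  · rw [Ne, map_eq_zero_iff _ PowerSeries.C_injective]
    exact PowerSeries.X_ne_zero
  · rw [PowerSeries.isUnit_iff_constantCoeff, PowerSeries.constantCoeff_C]
    exact PowerSeries.X_prime.not_isUnit
  · simp only [C_X_dvd_iff, map_mul, mul_eq_zero]
    exact id

theorem HasSqrtInSeries.of_tVar_pow_mul {f : K⟦X⟧[X]} {n : ℕ} (hf : f.map constantCoeff ≠ 0)
    (h : HasSqrtInSeries (tVar K ^ n * f)) : ∃ p, n = 2 * p ∧ HasSqrtInSeries f := by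
  obtain ⟨δ, hδ⟩ := h
  rw [tVar, Polynomial.coe_mul, Polynomial.coe_pow, coe_C] at hδ
  have hndvd : ¬ PowerSeries.C PowerSeries.X ∣ (f : K⟦X⟧⟦X⟧) := by
    rw [C_X_dvd_iff, ← polynomial_map_coe]
    exact_mod_cast hf
  obtain ⟨p, c, hn, hc⟩ := exists_eq_sq_of_prime_pow_mul_eq_sq prime_C_X hndvd hδ
  exact ⟨p, hn, c, hc⟩

/-- Exchange of the two variables of an iterated power series ring. -/
noncomputable def swapVars (R : Type*) [CommSemiring R] : R⟦X⟧⟦X⟧ →+* R⟦X⟧⟦X⟧ where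
  toFun f := PowerSeries.mk fun n ↦ PowerSeries.mk fun m ↦
    PowerSeries.coeff n (PowerSeries.coeff m f)
  map_one' := by
    ext n m
    simp only [PowerSeries.coeff_mk, PowerSeries.coeff_one]
    split_ifs <;> simp_all [PowerSeries.coeff_one]
  map_zero' := by ext; simp
  map_add' f g := by ext; simp
  map_mul' f g := by
    ext n m
    simp only [PowerSeries.coeff_mk, PowerSeries.coeff_mul, map_sum]
    exact Finset.sum_comm

theorem coeff_coeff_swapVars {R : Type*} [CommSemiring R] (f : R⟦X⟧⟦X⟧) (n m : ℕ) :
    PowerSeries.coeff m (PowerSeries.coeff n (swapVars R f)) =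
      PowerSeries.coeff n (PowerSeries.coeff m f) := by
  simp [swapVars]

theorem swapVars_C {R : Type*} [CommSemiring R] (f : R⟦X⟧) :
    swapVars R (PowerSeries.C f) = f.map PowerSeries.C := by
  ext n m
  rw [coeff_coeff_swapVars, PowerSeries.coeff_map, PowerSeries.coeff_C, PowerSeries.coeff_C]
  split_ifs <;> simp

theorem swapVars_map_C {R : Type*} [CommSemiring R] (f : R⟦X⟧) :
    swapVars R (f.map PowerSeries.C) = PowerSeries.C f := by
  ext n m
  rw [coeff_coeff_swapVars, PowerSeries.coeff_map, PowerSeries.coeff_C, PowerSeries.coeff_C]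
  split_ifs <;> simp

variable {L : Type*} [Field L]

/-- The map `K[u][[t]] → L[[t]][[u]]` induced by a map `K → L` of coefficients and the substitution
`u ↦ u + α`. -/
noncomputable def shiftSeries (φ : K →+* L) (α : L) : K[X]⟦X⟧ →+* L⟦X⟧⟦X⟧ :=
  (swapVars L).comp (PowerSeries.map
    (eval₂RingHom (PowerSeries.C.comp φ) (PowerSeries.X + PowerSeries.C α)))

theorem shiftSeries_toPolySeries (φ : K →+* L) (α : L) (f : K⟦X⟧[X]) :
    shiftSeries φ α (toPolySeries K f) =
      (taylor (PowerSeries.C α) (f.map (PowerSeries.map φ)) : L⟦X⟧[X]) := by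
  have h : (shiftSeries φ α).comp (toPolySeries K) =
      Polynomial.coeToPowerSeries.ringHom.comp
        ((taylorAlgHom (PowerSeries.C α)).toRingHom.comp (mapRingHom (PowerSeries.map φ))) := by
    refine Polynomial.ringHom_ext (fun a ↦ ?_) ?_
    · have hmap : PowerSeries.map (eval₂RingHom ((PowerSeries.C (R := L)).comp φ)
          (PowerSeries.X + PowerSeries.C α)) (PowerSeries.map C a) =
          PowerSeries.map PowerSeries.C (PowerSeries.map φ a) := by
        ext1 n
        simp
      simp [shiftSeries, toPolySeries, hmap, swapVars_map_C]
    · simp [shiftSeries, toPolySeries, swapVars_C]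
  exact congr($h f)

theorem HasSqrtInPolySeries.hasSqrtInSeries_taylor_map {Δ : K⟦X⟧[X]} (h : HasSqrtInPolySeries Δ)
    (φ : K →+* L) (α : L) :
    HasSqrtInSeries (taylor (PowerSeries.C α) (Δ.map (PowerSeries.map φ))) := by
  obtain ⟨δ, hδ⟩ := h
  exact ⟨shiftSeries φ α δ, by rw [← shiftSeries_toPolySeries, hδ, map_pow]⟩

theorem HasSqrtInPolySeries.hasSqrtInSeries {Δ : K⟦X⟧[X]} (h : HasSqrtInPolySeries Δ) :
    HasSqrtInSeries Δ := by
  have hid : PowerSeries.map (RingHom.id K) = RingHom.id K⟦X⟧ := by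
    ext1 f
    exact congr($PowerSeries.map_id f)
  simpa only [hid, map_id, map_zero, taylor_zero] using
    h.hasSqrtInSeries_taylor_map (RingHom.id K) 0

theorem HasSqrtInSeries.exists_eq_mul {Δ : K⟦X⟧[X]} (hΔ : Δ ≠ 0) (h : HasSqrtInSeries Δ) :
    ∃ (p d : ℕ) (c : K) (S : K⟦X⟧) (R₁ R₂ F : K⟦X⟧[X]), c ≠ 0 ∧ R₂.degree < (d : WithBot ℕ) ∧
      F.coeff 0 = 1 ∧ F.natDegree ≤ (F.map constantCoeff).natDegree ∧
      Δ = C (PowerSeries.C c) ^ 2 * tVar K ^ (2 * p) * unitFactor S * infFactor R₁ *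
        zeroFactor d R₂ ^ 2 * F := by
  obtain ⟨n, f, rfl, hf⟩ := exists_eq_tVar_pow_mul hΔ
  obtain ⟨p, rfl, hfsqrt⟩ := h.of_tVar_pow_mul hf
  obtain ⟨P, g, hP, hg, rfl⟩ := exists_eq_isConcentratedAt_mul hf 0
  obtain ⟨Q, v, hQ, rfl, hgv⟩ := hP.exists_eq_sq hg (by rwa [map_zero, taylor_zero])
  rw [map_zero, ← coeff_zero_eq_eval_zero] at hgv
  rw [← coeff_zero_eq_eval_zero, coeff_map] at hg
  have hv : constantCoeff v ≠ 0 := by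
    rw [hgv, map_pow] at hg
    exact ne_zero_pow two_ne_zero hg
  obtain ⟨g', hg'0, hgg'⟩ := exists_eq_C_mul_of_constantCoeff_ne_zero hg
  obtain ⟨S, hS⟩ := exists_eq_C_sq_mul_unitFactor hv
  obtain ⟨R₁, F, hF0, hF, rfl⟩ := exists_eq_infFactor_mul hg'0
  obtain ⟨R₂, hR₂, hQR₂⟩ := hQ.exists_eq_zeroFactor
  refine ⟨p, Q.natDegree, constantCoeff v, S, R₁, R₂, F, hv, hR₂, hF0, hF, ?_⟩
  rw [← hQR₂, hgg', hgv, hS]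
  ring

end SquareRoots

section BaseChange

variable {K : Type*} [Field K]

theorem map_constantCoeff_baseChange (f : K⟦X⟧[X]) :
    (baseChange K f).map constantCoeff =
      (f.map constantCoeff).map (algebraMap K (AlgebraicClosure K)) := by
  ext n
  simp only [baseChange, coe_mapRingHom, coeff_map,
    ← PowerSeries.coeff_zero_eq_constantCoeff_apply, PowerSeries.coeff_map]

theorem natDegree_baseChange_le_natDegree_map {F : K⟦X⟧[X]}
    (h : F.natDegree ≤ (F.map constantCoeff).natDegree) :
    (baseChange K F).natDegree ≤ ((baseChange K F).map constantCoeff).natDegree := by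
  rw [map_constantCoeff_baseChange, natDegree_map]
  exact natDegree_map_le.trans h

theorem coeff_zero_baseChange {F : K⟦X⟧[X]} (h : F.coeff 0 = 1) :
    (baseChange K F).coeff 0 = 1 := by
  rw [baseChange, coe_mapRingHom, coeff_map, h, map_one]

theorem HasSqrtInPolySeries.hasSqrtInSeries_taylor_baseChange {f : K⟦X⟧[X]} {n : ℕ}
    (hf : f.map constantCoeff ≠ 0) (h : HasSqrtInPolySeries (tVar K ^ n * f))
    (α : AlgebraicClosure K) :
    HasSqrtInSeries (taylor (PowerSeries.C α) (baseChange K f)) := by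
  have ht : taylor (PowerSeries.C α) (baseChange K (tVar K ^ n * f)) =
      tVar (AlgebraicClosure K) ^ n * taylor (PowerSeries.C α) (baseChange K f) := by
    rw [map_mul, map_pow, taylor_mul, taylor_pow]
    congr 2
    simp only [baseChange, tVar, coe_mapRingHom, map_C, PowerSeries.map_X, taylor_C]
  have hred : (taylor (PowerSeries.C α) (baseChange K f)).map constantCoeff ≠ 0 := by
    rwa [map_taylor, Ne, taylor_eq_zero, map_constantCoeff_baseChange, Polynomial.map_eq_zero]
  have hsqrt := h.hasSqrtInSeries_taylor_map (algebraMap K (AlgebraicClosure K)) α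
  rw [← coe_mapRingHom, ← baseChange, ht] at hsqrt
  obtain ⟨-, -, hf⟩ := hsqrt.of_tVar_pow_mul hred
  exact hf

theorem HasSqrtInPolySeries.exists_baseChange_eq_sq {V F : K⟦X⟧[X]} {n : ℕ}
    (h : HasSqrtInPolySeries (tVar K ^ n * (V * F))) (hF : F.coeff 0 = 1)
    (hdeg : F.natDegree ≤ (F.map constantCoeff).natDegree)
    (hV : ∀ α ≠ 0, ((baseChange K V).map constantCoeff).eval α ≠ 0) :
    ∃ f, IsProdFinFactor f ∧ baseChange K F = f ^ 2 := by
  have hredV : V.map constantCoeff ≠ 0 := fun h0 ↦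
    hV 1 one_ne_zero (by rw [map_constantCoeff_baseChange, h0, Polynomial.map_zero, eval_zero])
  have hredF : F.map constantCoeff ≠ 0 := fun h0 ↦ by
    simpa [hF] using congr(Polynomial.coeff $h0 0)
  refine exists_isProdFinFactor_eq_sq (V := baseChange K V) (coeff_zero_baseChange hF)
    (natDegree_baseChange_le_natDegree_map hdeg) hV fun α _ ↦ ?_
  rw [← map_mul]
  refine h.hasSqrtInSeries_taylor_baseChange ?_ α
  rw [Polynomial.map_mul]
  exact mul_ne_zero hredV hredF

theorem eval_map_constantCoeff_baseChange_ne_zero {c : K} (hc : c ≠ 0) (S : K⟦X⟧)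
    (R₁ R₂ : K⟦X⟧[X]) (d : ℕ) {α : AlgebraicClosure K} (hα : α ≠ 0) :
    ((baseChange K (C (PowerSeries.C c) ^ 2 * unitFactor S * infFactor R₁ *
      zeroFactor d R₂ ^ 2)).map constantCoeff).eval α ≠ 0 := by
  rw [map_constantCoeff_baseChange]
  simp [hc, hα]

end BaseChange

end BrownSquare

theorem mainTheorem3 {K : Type*} [Field K] (Δ : Polynomial (PowerSeries K)) :
    (BrownSquare.HasSqrtInSeries Δ →
      ∃ (p d k : ℕ) (c : K) (S : PowerSeries K) (R₁ R₂ : Polynomial (PowerSeries K))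
        (α : Fin k → AlgebraicClosure K) (e : Fin k → ℕ)
        (Q : Fin k → Polynomial (PowerSeries (AlgebraicClosure K))),
        R₂.degree < (d : WithBot ℕ) ∧
        Function.Injective α ∧
        (∀ i, α i ≠ 0 ∧ 0 < e i ∧ (Q i).degree < (e i : WithBot ℕ)) ∧
        BrownSquare.baseChange K Δ =
          BrownSquare.baseChange K
            (Polynomial.C (PowerSeries.C c) ^ 2 * BrownSquare.tVar K ^ (2 * p) *
              BrownSquare.unitFactor S * BrownSquare.infFactor R₁ *
              BrownSquare.zeroFactor d R₂ ^ 2) *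
          ∏ i, BrownSquare.finFactor (α i) (e i) (Q i)) ∧
    (BrownSquare.HasSqrtInPolySeries Δ →
      ∃ (p d k : ℕ) (c : K) (S : PowerSeries K) (R₁ R₂ : Polynomial (PowerSeries K))
        (α : Fin k → AlgebraicClosure K) (e : Fin k → ℕ)
        (Q : Fin k → Polynomial (PowerSeries (AlgebraicClosure K))),
        R₂.degree < (d : WithBot ℕ) ∧
        Function.Injective α ∧
        (∀ i, α i ≠ 0 ∧ 0 < e i ∧ (Q i).degree < (e i : WithBot ℕ)) ∧
        BrownSquare.baseChange K Δ =
          BrownSquare.baseChange K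
            (Polynomial.C (PowerSeries.C c) ^ 2 * BrownSquare.tVar K ^ (2 * p) *
              BrownSquare.unitFactor S * BrownSquare.infFactor R₁ *
              BrownSquare.zeroFactor d R₂ ^ 2) *
          ∏ i, BrownSquare.finFactor (α i) (e i) (Q i) ^ 2) := by
  rcases eq_or_ne Δ 0 with rfl | hΔ
  · constructor <;> intro _ <;>
    exact ⟨0, 0, 0, 0, 0, 0, 0, Fin.elim0, Fin.elim0, Fin.elim0, by simp,
      Function.injective_of_subsingleton _, fun i ↦ i.elim0, by simp⟩
  constructor
  · intro h
    obtain ⟨p, d, c, S, R₁, R₂, F, -, hR₂, hF0, hdeg, hΔF⟩ := h.exists_eq_mul hΔ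
    obtain ⟨k, α, e, Q, hα, hQ, hF⟩ := BrownSquare.isProdFinFactor_of_natDegree_le
      (BrownSquare.coeff_zero_baseChange hF0)
      (BrownSquare.natDegree_baseChange_le_natDegree_map hdeg)
    exact ⟨p, d, k, c, S, R₁, R₂, α, e, Q, hR₂, hα, hQ, by rw [← hF, ← map_mul, ← hΔF]⟩
  · intro h
    obtain ⟨p, d, c, S, R₁, R₂, F, hc, hR₂, hF0, hdeg, hΔF⟩ := h.hasSqrtInSeries.exists_eq_mul hΔ
    obtain ⟨f, ⟨k, α, e, Q, hα, hQ, rfl⟩, hf⟩ :=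
      BrownSquare.HasSqrtInPolySeries.exists_baseChange_eq_sq (n := 2 * p)
        (by convert h using 1; rw [hΔF]; ring) hF0 hdeg fun α ↦
          BrownSquare.eval_map_constantCoeff_baseChange_ne_zero hc S R₁ R₂ d
    exact ⟨p, d, k, c, S, R₁, R₂, α, e, Q, hR₂, hα, hQ, by
      rw [Finset.prod_pow, ← hf, ← map_mul, ← hΔF]⟩
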